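/- Let $T_{\mathbb C}=\mathfrak t_{\mathbb C}/\Lambda$ be a complex torus of dimension $n$, where $\Lambda=\ker(\exp)$ is the coweight lattice (a subgroup of $\mathfrak t_{\mathbb C}$ having a $\mathbb Z$-basis that is a $\mathbb C$-basis of $\mathfrak t_{\mathbb C}$), and let $M$ be a complex toric manifold for $T_{\mathbb C}$: a complex manifold of dimension $n$ on which $T_{\mathbb C}$ acts holomorphically and effectively with an open dense orbit. For $\xi\in\mathfrak t_{\mathbb C}$ let $X_\xi$ be the induced holomorphic vector field (the $(1,0)$-part of the vector field with value $\frac{d}{dt}\big|_{0}\exp(t\xi)\cdot x$ at $x$), and let $Z_\xi=\frac1{2\pi i}X_\xi$; for $\xi\in\Lambda$ the field $Z_\xi$ generates the action of $z=e^s\in\mathbb C^{*}$ by $z^\xi=\exp\big(\frac{\log z}{2\pi i}\,\xi\big)$. For a Hermitian form $B$ on $\mathfrak t_{\mathbb C}^*$ (linear in the first and conjugate-linear in the second variable) and a $\mathbb C$-basis $\xi_1,\dots,\xi_n$ of $\mathfrak t_{\mathbb C}$ with dual basis $\xi_1^*,\dots,\xi_n^*$, put $B_{pq}=B(\xi_p^*,\xi_q^*)$.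 1. The assignment $$B\longmapsto 2i\sum_{p,q=1}^n B_{pq}\,X_{\xi_p}\wedge\overline{X_{\xi_q}}$$ does not depend on the basis, and is a bijection from the Hermitian forms on $\mathfrak t_{\mathbb C}^*$ onto the real $T_{\mathbb C}$-invariant (smooth) Poisson structures of type $(1,1)$ on $M$. 2. The same is true of the rescaled assignment $$B\longmapsto \pi_B=-2i\sum_{p,q=1}^n B_{pq}\,Z_{\xi_p}\wedge\overline{Z_{\xi_q}}.$$ 3. Suppose moreover that $M$ is the smooth toric variety of a fan $\Sigma$ in $\mathfrak t=\mathbb R\Lambda$. Let $\xi_1,\dots,\xi_n$ be a $\mathbb Z$-basis of $\Lambda$ spanning a cone of $\Sigma$, and let $(z_1,\dots,z_n)\colon U\to\mathbb C^n$ be a distinguished holomorphic chart attached to this cone, i.e. a biholomorphic map from the corresponding affine open subset $U\subset M$ onto $\mathbb C^n$ in which $w_1^{\xi_1}\cdots w_n^{\xi_n}\in T_{\mathbb C}$ acts by $(z_p)\mapsto(w_pz_p)$. Then for every Hermitian form $B$ on $\mathfrak t_{\mathbb C}^*$, on $U$, $$\pi_B=-2i\sum_{p,q=1}^n B_{pq}\,z_p\bar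 z_q\,\partial_{z_p}\wedge\partial_{\bar z_q},$$ where $[B_{pq}]$ is the matrix of $B$ in the basis $\xi_1,\dots,\xi_n$. -/

import Mathlib

open scoped Manifold ContDiff ComplexConjugate

/-!
# Bivectors on a complex vector space, regarded as a real one

For a complex vector space `E` of finite dimension (a tangent space of a complex manifold), the
complexified cotangent space `Hom_ℝ(E, ℂ)` is a complex vector space, and its complex dual is the
complexified tangent space `E ⊗_ℝ ℂ`.  Complex bivectors, that is elements of `Λ²(E ⊗_ℝ ℂ)`, are
the alternating `ℂ`-bilinear forms on the complexified cotangent space.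
-/

section LinearAlgebra

variable (E : Type*) [NormedAddCommGroup E] [NormedSpace ℝ E] [NormedSpace ℂ E]

/-- The complexified cotangent space `Hom_ℝ(E, ℂ)`. -/
abbrev CCotangent : Type _ := E →L[ℝ] ℂ

/-- The complexified tangent space `E ⊗_ℝ ℂ`, as the complex dual of `Hom_ℝ(E, ℂ)`. -/
abbrev CTangent : Type _ := Module.Dual ℂ (CCotangent E)

/-- Complex bivectors: alternating `ℂ`-bilinear forms on the complexified cotangent space. -/
def CBivector : Submodule ℂ (CCotangent E →ₗ[ℂ] CCotangent E →ₗ[ℂ] ℂ) where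
  carrier := {b | ∀ α, b α α = 0}
  add_mem' := by
    intro a b ha hb α
    simp [ha α, hb α]
  zero_mem' := by
    intro α
    simp
  smul_mem' := by
    intro c a ha α
    simp [ha α]

variable {E}

/-- Complex conjugation of complex covectors. -/
noncomputable def conjCovec (α : CCotangent E) : CCotangent E :=
  (Complex.conjCLE : ℂ →L[ℝ] ℂ).comp α

/-- Multiplication by `i` on `E` (the complex structure `J`), as a real-linear map. -/
noncomputable def complexStructure [IsScalarTower ℝ ℂ E] : E →L[ℝ] E :=
  ((Complex.I • ContinuousLinearMap.id ℂ E : E →L[ℂ] E)).restrictScalars ℝ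

/-- The image `v ⊗ 1` of a real tangent vector in the complexified tangent space. -/
noncomputable def toCTangent (v : E) : CTangent E where
  toFun α := α v
  map_add' _ _ := rfl
  map_smul' _ _ := rfl

/-- Complex conjugation on the complexified tangent space. -/
noncomputable def conjVec (u : CTangent E) : CTangent E where
  toFun α := conj (u (conjCovec α))
  map_add' α β := by
    have h : conjCovec (α + β) = conjCovec α + conjCovec β := by
      ext v; simp [conjCovec]
    rw [h, map_add, map_add]
  map_smul' c α := by
    have h : conjCovec (c • α) = conj c • conjCovec α := by
      ext v; simp [conjCovec]
    rw [h, map_smul]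
    simp

variable (E) in
/-- `T^{1,0}`: the complexified tangent vectors on which (the `ℂ`-linear extension of) the complex
structure acts as multiplication by `i`. -/
def holTangent [IsScalarTower ℝ ℂ E] : Set (CTangent E) :=
  {u | ∀ α : CCotangent E, u (α.comp complexStructure) = Complex.I * u α}

variable (E) in
/-- `T^{0,1}`: the complexified tangent vectors on which (the `ℂ`-linear extension of) the complex
structure acts as multiplication by `-i`. -/
def antiholTangent [IsScalarTower ℝ ℂ E] : Set (CTangent E) :=
  {u | ∀ α : CCotangent E, u (α.comp complexStructure) = -Complex.I * u α}

/-- The component `(v - i J v) / 2` in `T^{1,0}` of a real tangent vector `v`. -/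
noncomputable def holPart (v : E) : CTangent E :=
  (1 / 2 : ℂ) • (toCTangent v - Complex.I • toCTangent (Complex.I • v))

/-- The wedge product of two complexified tangent vectors:
`(u ∧ w)(α, β) = u(α) w(β) - u(β) w(α)`. -/
noncomputable def wedge (u w : CTangent E) : CBivector E :=
  ⟨LinearMap.mk₂ ℂ (fun α β => u α * w β - u β * w α)
    (by intro α α' β; simp only [map_add]; ring)
    (by intro c α β; simp only [map_smul, smul_eq_mul]; ring)
    (by intro α β β'; simp only [map_add]; ring)
    (by intro c α β; simp only [map_smul, smul_eq_mul]; ring),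
   by intro α; simp only [LinearMap.mk₂_apply]; ring⟩

/-- A bivector is real if it is fixed by complex conjugation. -/
def CBivector.IsReal (b : CBivector E) : Prop :=
  ∀ α β : CCotangent E, conj (b.1 (conjCovec α) (conjCovec β)) = b.1 α β

/-- A bivector is of type `(1,1)` if it lies in `T^{1,0} ∧ T^{0,1}`. -/
def CBivector.IsType11 [IsScalarTower ℝ ℂ E] (b : CBivector E) : Prop :=
  b ∈ Submodule.span ℂ {c : CBivector E | ∃ u ∈ holTangent E, ∃ w ∈ antiholTangent E, c = wedge u w}

/-- The push-forward of a bivector under a real-linear map. -/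
noncomputable def CBivector.map {F : Type*} [NormedAddCommGroup F] [NormedSpace ℝ F]
    [NormedSpace ℂ F] (L : E →L[ℝ] F) (b : CBivector E) : CBivector F :=
  ⟨LinearMap.mk₂ ℂ (fun α β => b.1 (α.comp L) (β.comp L))
    (by intro α α' β; simp only [ContinuousLinearMap.add_comp, map_add, LinearMap.add_apply])
    (by intro c α β
        simp only [ContinuousLinearMap.smul_comp, map_smul, LinearMap.smul_apply])
    (by intro α β β'; simp only [ContinuousLinearMap.add_comp, map_add])
    (by intro c α β; simp only [ContinuousLinearMap.smul_comp, map_smul]),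
   fun α => b.2 (α.comp L)⟩

end LinearAlgebra

/-! # Poisson structures of type `(1,1)` on complex manifolds of dimension `n` -/

section Poisson

variable {n : ℕ} {M : Type*} [TopologicalSpace M] [ChartedSpace (Fin n → ℂ) M]

/-- The differential at `x` of a map between complex manifolds, as real manifolds. -/
noncomputable abbrev realDeriv {m : ℕ} {N : Type*} [TopologicalSpace N]
    [ChartedSpace (Fin m → ℂ) N] (f : M → N) (x : M) : (Fin n → ℂ) →L[ℝ] (Fin m → ℂ) :=
  mfderiv 𝓘(ℝ, Fin n → ℂ) 𝓘(ℝ, Fin m → ℂ) f x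

/-- The differential at `x` of a complex-valued function, as a complex covector. -/
noncomputable abbrev realDiff (f : M → ℂ) (x : M) : CCotangent (Fin n → ℂ) :=
  mfderiv 𝓘(ℝ, Fin n → ℂ) 𝓘(ℝ, ℂ) f x

variable (n M) in
/-- Bivector fields on `M` (sections of `Λ²(TM ⊗_ℝ ℂ)`, without regularity); the tangent space of
`M` at each point is `ℂⁿ`. -/
abbrev BivectorField : Type _ := M → CBivector (Fin n → ℂ)

/-- A bivector field is smooth if its coefficients in the charts of the atlas are smooth. -/
def BivectorField.IsSmooth (π : BivectorField n M) : Prop :=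
  ∀ c ∈ atlas (Fin n → ℂ) M, ∀ α β : CCotangent (Fin n → ℂ),
    ContMDiffOn 𝓘(ℝ, Fin n → ℂ) 𝓘(ℝ, ℂ) ∞
      (fun x => (CBivector.map (realDeriv c x) (π x)).1 α β) c.source

/-- The bracket `{f, g} = π(df, dg)`. -/
noncomputable def BivectorField.bracket (π : BivectorField n M) (f g : M → ℂ) : M → ℂ :=
  fun x => (π x).1 (realDiff f x) (realDiff g x)

/-- A Poisson structure: a smooth bivector field whose bracket satisfies the Jacobi identity on
(locally defined) smooth functions. -/
structure BivectorField.IsPoisson (π : BivectorField n M) : Prop where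
  smooth : π.IsSmooth
  jacobi : ∀ U : Set M, IsOpen U → ∀ f g h : M → ℂ,
    ContMDiffOn 𝓘(ℝ, Fin n → ℂ) 𝓘(ℝ, ℂ) ∞ f U →
    ContMDiffOn 𝓘(ℝ, Fin n → ℂ) 𝓘(ℝ, ℂ) ∞ g U →
    ContMDiffOn 𝓘(ℝ, Fin n → ℂ) 𝓘(ℝ, ℂ) ∞ h U →
    ∀ x ∈ U, π.bracket f (π.bracket g h) x + π.bracket g (π.bracket h f) x
      + π.bracket h (π.bracket f g) x = 0

end Poisson

/-!
# Complex tori and complex toric manifolds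

A complex torus `T_ℂ` is given by its Lie algebra `V = 𝔱_ℂ` and the kernel `Λ` of its exponential
map, the coweight lattice: `T_ℂ = V ⧸ Λ`, with exponential map the quotient map (so `T_ℂ` is
written additively and its action on a manifold is an additive action).
-/

section Toric

variable {n : ℕ} {V : Type*} [NormedAddCommGroup V] [NormedSpace ℂ V]

/-- A `ℂ`-basis of `V` which is a `ℤ`-basis of `Λ`. -/
def IsIntegralBasis (Λ : AddSubgroup V) (ξ : Module.Basis (Fin n) ℂ V) : Prop :=
  Λ = AddSubgroup.closure (Set.range ξ)

/-- The action of `exp v` on `M`. -/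
def expAct (Λ : AddSubgroup V) {M : Type*} [AddAction (V ⧸ Λ) M] (v : V) (x : M) : M :=
  (QuotientAddGroup.mk v : V ⧸ Λ) +ᵥ x

/-- The complex manifold `M` is a complex toric manifold for `T_ℂ = V ⧸ Λ`: the group `T_ℂ` is a
complex torus (`Λ` has a `ℤ`-basis which is a `ℂ`-basis of `V`), and it acts holomorphically and
effectively with an open dense orbit.  The torus and `M` have the same dimension `n`. -/
structure IsComplexToricManifold (n : ℕ) (Λ : AddSubgroup V) (M : Type*) [TopologicalSpace M]
    [ChartedSpace (Fin n → ℂ) M] [AddAction (V ⧸ Λ) M] : Prop where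
  lattice : ∃ ξ : Module.Basis (Fin n) ℂ V, IsIntegralBasis Λ ξ
  holomorphic : ContMDiff (𝓘(ℂ, V).prod 𝓘(ℂ, Fin n → ℂ)) 𝓘(ℂ, Fin n → ℂ) ω
    (fun p : V × M => expAct Λ p.1 p.2)
  effective : ∀ t : V ⧸ Λ, (∀ x : M, t +ᵥ x = x) → t = 0
  openDenseOrbit : ∃ x : M, IsOpen (AddAction.orbit (V ⧸ Λ) x) ∧ Dense (AddAction.orbit (V ⧸ Λ) x)

variable (Λ : AddSubgroup V) {M : Type*} [TopologicalSpace M]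
  [ChartedSpace (Fin n → ℂ) M] [AddAction (V ⧸ Λ) M]

variable (M) in
/-- The real vector field on `M` generated by `ξ ∈ 𝔱_ℂ`: its value at `x` is the image of `ξ` under
the differential at `0` of `v ↦ exp(v) · x`. -/
noncomputable def generatedField (ξ : V) (x : M) : Fin n → ℂ :=
  (mfderiv 𝓘(ℂ, V) 𝓘(ℂ, Fin n → ℂ) (fun v : V => expAct Λ v x) 0 : V →L[ℂ] (Fin n → ℂ)) ξ

variable (M) in
/-- The holomorphic vector field `X_ξ` (a section of `T^{1,0}`) induced by `ξ ∈ 𝔱_ℂ`. -/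
noncomputable def holField (ξ : V) (x : M) : CTangent (Fin n → ℂ) :=
  holPart (generatedField Λ M ξ x)

variable (M) in
/-- The holomorphic vector field `Z_ξ = (2πi)⁻¹ X_ξ`.  For `ξ ∈ Λ` it generates the action
`z ↦ z^ξ = exp((log z / 2πi) ξ)` of the nonzero complex numbers, with respect to `z = e^s`. -/
noncomputable def holFieldZ (ξ : V) (x : M) : CTangent (Fin n → ℂ) :=
  (2 * (Real.pi : ℂ) * Complex.I)⁻¹ • holField Λ M ξ x

/-- A toric bivector field: invariant under the action of `T_ℂ`. -/
def BivectorField.IsToric (π : BivectorField n M) : Prop :=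
  ∀ (t : V ⧸ Λ) (x : M), CBivector.map (realDeriv (fun y : M => t +ᵥ y) x) (π x) = π (t +ᵥ x)

variable (n M) in
/-- The real toric Poisson structures of type `(1,1)` on `M`. -/
def RealToricPoisson11 : Type _ :=
  {π : BivectorField n M // BivectorField.IsPoisson π ∧ BivectorField.IsToric Λ π ∧
    ∀ x, CBivector.IsReal (π x) ∧ CBivector.IsType11 (π x)}

variable (V) in
/-- Hermitian forms on `𝔱_ℂ^* = V^*`, linear in the first and antilinear in the second variable. -/
def HermitianFormDual : Type _ :=
  {B : Module.Dual ℂ V →ₗ[ℂ] Module.Dual ℂ V →ₗ⋆[ℂ] ℂ // ∀ f g, B g f = conj (B f g)}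

/-- The matrix `B_pq = B(ξ_p^*, ξ_q^*)` of a Hermitian form on `V^*` with respect to a basis `ξ` of
`V`, with `ξ^*` the dual basis of `V^*`. -/
noncomputable def HermitianFormDual.matrix (B : HermitianFormDual V)
    (ξ : Module.Basis (Fin n) ℂ V) (p q : Fin n) : ℂ :=
  B.1 (ξ.coord p) (ξ.coord q)

/-! ## Fans and smooth toric varieties -/

/-- A smooth fan: a finite set of cones, each generated by part of a `ℤ`-basis of `Λ`, closed under
faces and such that any two cones intersect in a common face. -/
structure SmoothFan (n : ℕ) (Λ : AddSubgroup V) where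
  /-- The cones of the fan. -/
  cones : Set (PointedCone ℝ V)
  finite : cones.Finite
  smooth : ∀ σ ∈ cones, ∃ ξ : Module.Basis (Fin n) ℂ V, IsIntegralBasis Λ ξ ∧
    ∃ s : Set (Fin n), σ = PointedCone.hull ℝ (ξ '' s)
  face : ∀ σ ∈ cones, ∀ τ : PointedCone ℝ V, τ.IsFaceOf σ → τ ∈ cones
  inter : ∀ σ ∈ cones, ∀ τ ∈ cones, (σ ⊓ τ).IsFaceOf σ ∧ (σ ⊓ τ).IsFaceOf τ

/-- `φ` is an equivariant holomorphic chart from the open set `U` onto `ℂˢ × (ℂ \ {0})^{sᶜ}`, the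
affine toric variety of the cone spanned by the `ξ_p` with `p ∈ s`, where
`z_1^{ξ_1} ⋯ z_n^{ξ_n} ∈ T_ℂ` acts by multiplying the coordinates by `z_1, …, z_n`. -/
structure IsToricChart (ξ : Module.Basis (Fin n) ℂ V) (s : Set (Fin n)) (U : Set M)
    (φ : OpenPartialHomeomorph M (Fin n → ℂ)) : Prop where
  source_eq : φ.source = U
  target_eq : φ.target = {z | ∀ p, p ∉ s → z p ≠ 0}
  holomorphic : ContMDiffOn 𝓘(ℂ, Fin n → ℂ) 𝓘(ℂ, Fin n → ℂ) ω φ U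
  holomorphic_symm : ContMDiffOn 𝓘(ℂ, Fin n → ℂ) 𝓘(ℂ, Fin n → ℂ) ω φ.symm φ.target
  equivariant : ∀ v : V, ∀ x ∈ U, expAct Λ v x ∈ U ∧
    ∀ p, φ (expAct Λ v x) p = Complex.exp (2 * Real.pi * Complex.I * ξ.repr v p) * φ x p

/-- The complex toric manifold `M` is the smooth toric variety of the fan `F`, with `U σ` the affine
open subset attached to `σ ∈ F`: these subsets cover `M`, are glued as prescribed by the fan, and
each `U σ` is equivariantly biholomorphic to the affine toric variety of `σ`. -/
structure IsSmoothToricVariety (F : SmoothFan n Λ) (U : PointedCone ℝ V → Set M) : Prop where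
  toric : IsComplexToricManifold n Λ M
  cover : ∀ x : M, ∃ σ ∈ F.cones, x ∈ U σ
  inter : ∀ σ ∈ F.cones, ∀ τ ∈ F.cones, U (σ ⊓ τ) = U σ ∩ U τ
  chart : ∀ σ ∈ F.cones, ∀ (ξ : Module.Basis (Fin n) ℂ V) (s : Set (Fin n)),
    IsIntegralBasis Λ ξ → σ = PointedCone.hull ℝ (ξ '' s) →
    ∃ φ : OpenPartialHomeomorph M (Fin n → ℂ), IsToricChart Λ ξ s (U σ) φ

/-- The vector `∂/∂z_p` on `ℂⁿ`. -/
noncomputable def partialZ (p : Fin n) : CTangent (Fin n → ℂ) :=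
  holPart (Pi.single p 1)

/-- The vector `∂/∂z̄_p` on `ℂⁿ`. -/
noncomputable def partialZBar (p : Fin n) : CTangent (Fin n → ℂ) :=
  conjVec (partialZ p)

end Toric

/-!
# Toric Poisson structures of type `(1,1)` and Hermitian forms

The orbit map `o_x : v ↦ exp(v) · x` from the Lie algebra `V` to `M` is holomorphic, and its
differential `orbitDeriv` at `0` sends `ξ` to the value at `x` of the field generated by `ξ`.
Hence a constant bivector `P` on `V` induces a bivector field `orbitBivector P` on `M`, whose value
at `x` is the push-forward of `P` under `orbitDeriv x`.  A Hermitian form `B` on `V^*` gives such a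
bivector, `2i ∑ B_pq ξ_p ∧ ξ̄_q`; written as
`(α, β) ↦ 2i (B(α', (β̄)') - B(β', (ᾱ)'))`, where `α'` denotes the `ℂ`-linear part of a covector
`α`, it visibly does not depend on the basis (`HermitianFormDual.bivector`).

The field `orbitBivector P` is toric because the torus is commutative.  It is Poisson for *every*
constant `P`: the field is `o_x`-related to `P`, so the Jacobi identity at `x` becomes the one for
a constant bivector on a vector space, which holds because Hessians are symmetric
(`CBivector.jacobi_of_symmetric`).

At a point `x₀` of the open orbit `orbitDeriv x₀` is invertible: its rank is constant along the
orbit, and if it were not maximal, then the orbit, read in a chart, would be an open set of measure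
zero (`IsComplexToricManifold.exists_equiv_eq_orbitDeriv`).  Therefore `B` can be recovered from
the value at `x₀`.  Conversely the value at `x₀` of a real toric field of type `(1,1)` is
transported to a real bivector of type `(1,1)` on `V`, which comes from a Hermitian form
(`HermitianFormDual.exists_bivector_eq`); the two toric fields agree at `x₀`, hence on the orbit,
and by density everywhere (`BivectorField.eq_of_isToric_of_isSmooth`).

The second correspondence is the first one composed with the scaling of Hermitian forms by
`-1/(4π²)`, and the formula in a distinguished chart follows from the fact that `ξ_p` generates
there the vector field `2πi z_p ∂/∂z_p`.
-/

open scoped Topology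

/-! ### Hermitian forms and bivectors of type `(1,1)` on a complex vector space -/

section Bivectors

variable {E : Type*} [NormedAddCommGroup E] [NormedSpace ℝ E]

theorem conjCovec_apply (α : CCotangent E) (v : E) : conjCovec α v = conj (α v) := rfl

theorem conjCovec_conjCovec (α : CCotangent E) : conjCovec (conjCovec α) = α := by
  ext v; simp [conjCovec_apply]

theorem conjCovec_add (α β : CCotangent E) :
    conjCovec (α + β) = conjCovec α + conjCovec β := by
  ext v; simp [conjCovec_apply]

theorem conjCovec_smul (c : ℂ) (α : CCotangent E) :
    conjCovec (c • α) = conj c • conjCovec α := by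
  ext v; simp [conjCovec_apply]

theorem conjVec_smul (c : ℂ) (u : CTangent E) : conjVec (c • u) = conj c • conjVec u := by
  ext α; simp [conjVec]

theorem wedge_apply (u w : CTangent E) (α β : CCotangent E) :
    (wedge u w).1 α β = u α * w β - u β * w α := rfl

theorem wedge_smul_smul (c d : ℂ) (u w : CTangent E) :
    wedge (c • u) (d • w) = (c * d) • wedge u w := by
  apply Subtype.ext
  ext α β
  simp only [wedge_apply, LinearMap.smul_apply, SetLike.val_smul, smul_eq_mul]
  ring

theorem CBivector.ext_apply {b c : CBivector E} (h : ∀ α β, b.1 α β = c.1 α β) : b = c := by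
  apply Subtype.ext
  ext α β
  exact h α β

theorem CBivector.sum_apply {ι : Type*} (s : Finset ι) (b : ι → CBivector E)
    (α β : CCotangent E) : (∑ i ∈ s, b i).1 α β = ∑ i ∈ s, (b i).1 α β := by
  simp [LinearMap.sum_apply]

theorem CBivector.smul_apply (c : ℂ) (b : CBivector E)
    (α β : CCotangent E) : (c • b).1 α β = c * b.1 α β := rfl

theorem CBivector.swap (b : CBivector E) (α β : CCotangent E) : b.1 α β = -b.1 β α := by
  have h := b.2 (α + β)
  simp only [map_add, LinearMap.add_apply, b.2 α, b.2 β] at h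
  linear_combination h

end Bivectors

section PushForward

variable {E F : Type*} [NormedAddCommGroup E] [NormedSpace ℝ E]
  [NormedAddCommGroup F] [NormedSpace ℝ F] [NormedSpace ℂ F]

theorem CBivector.map_apply (L : E →L[ℝ] F) (b : CBivector E) (α β : CCotangent F) :
    (CBivector.map L b).1 α β = b.1 (α.comp L) (β.comp L) := rfl

theorem CBivector.map_map {G : Type*} [NormedAddCommGroup G] [NormedSpace ℝ G] [NormedSpace ℂ G]
    (K : F →L[ℝ] G) (L : E →L[ℝ] F) (b : CBivector E) :
    CBivector.map K (CBivector.map L b) = CBivector.map (K.comp L) b := rfl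

theorem CBivector.map_id [NormedSpace ℂ E] (b : CBivector E) :
    CBivector.map (ContinuousLinearMap.id ℝ E) b = b := rfl

theorem CBivector.map_smul (L : E →L[ℝ] F) (c : ℂ) (b : CBivector E) :
    CBivector.map L (c • b) = c • CBivector.map L b := rfl

theorem CBivector.map_sum (L : E →L[ℝ] F) {ι : Type*} (s : Finset ι) (b : ι → CBivector E) :
    CBivector.map L (∑ i ∈ s, b i) = ∑ i ∈ s, CBivector.map L (b i) :=
  CBivector.ext_apply fun α β => by simp only [CBivector.map_apply, CBivector.sum_apply]

theorem CBivector.IsReal.map {b : CBivector E} (hb : CBivector.IsReal b) (L : E →L[ℝ] F) :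
    CBivector.IsReal (CBivector.map L b) :=
  fun α β => hb (α.comp L) (β.comp L)

end PushForward

section Type11

variable {E F : Type*} [NormedAddCommGroup E] [NormedSpace ℝ E] [NormedSpace ℂ E]
  [IsScalarTower ℝ ℂ E] [NormedAddCommGroup F] [NormedSpace ℝ F] [NormedSpace ℂ F]
  [IsScalarTower ℝ ℂ F]

theorem complexStructure_apply (v : E) : complexStructure v = Complex.I • v := rfl

theorem complex_smul_eq_add (c : ℂ) (v : E) :
    c • v = c.re • v + c.im • (Complex.I • v) := by
  conv_lhs => rw [← Complex.re_add_im c, add_smul, mul_smul]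
  rw [← algebraMap_smul ℂ c.re v, ← algebraMap_smul ℂ c.im (Complex.I • v)]
  rfl

/-- The `ℂ`-linear part `v ↦ (α(v) - i α(i v)) / 2` of a complex covector `α`. -/
noncomputable def linearPart (α : CCotangent E) : Module.Dual ℂ E where
  toFun v := (1 / 2 : ℂ) * (α v - Complex.I * α (Complex.I • v))
  map_add' v w := by simp only [smul_add, map_add]; ring
  map_smul' c v := by
    have h : Complex.I • c • v = c.re • (Complex.I • v) - c.im • v := by
      rw [smul_comm, complex_smul_eq_add c, ← mul_smul, Complex.I_mul_I, neg_one_smul]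
      simp [sub_eq_add_neg]
    rw [h, complex_smul_eq_add c v]
    simp only [map_add, map_sub, map_smul, Complex.real_smul, RingHom.id_apply, smul_eq_mul]
    conv_rhs => rw [← Complex.re_add_im c]
    linear_combination (c.im / 2 * α (Complex.I • v)) * Complex.I_mul_I

theorem linearPart_apply (α : CCotangent E) (v : E) :
    linearPart α v = (1 / 2 : ℂ) * (α v - Complex.I * α (Complex.I • v)) := rfl

theorem linearPart_add (α β : CCotangent E) :
    linearPart (α + β) = linearPart α + linearPart β := by
  ext v; simp [linearPart_apply]; ring

theorem linearPart_smul (c : ℂ) (α : CCotangent E) :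
    linearPart (c • α) = c • linearPart α := by
  ext v; simp [linearPart_apply]; ring

theorem holPart_apply (v : E) (α : CCotangent E) : holPart v α = linearPart α v := by
  simp [holPart, toCTangent, linearPart_apply]

theorem conjVec_holPart_apply (v : E) (α : CCotangent E) :
    conjVec (holPart v) α = conj (linearPart (conjCovec α) v) := by
  rw [← holPart_apply]; rfl

theorem holPart_smul (c : ℂ) (v : E) : holPart (c • v) = c • holPart v := by
  ext α; simp [holPart_apply]

theorem linearPart_comp (L : E →L[ℝ] F) (hL : ∀ v, L (Complex.I • v) = Complex.I • L v)
    (α : CCotangent F) (v : E) : linearPart (α.comp L) v = linearPart α (L v) := by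
  simp [linearPart_apply, hL]

theorem CBivector.map_wedge_holPart (L : E →L[ℝ] F)
    (hL : ∀ v, L (Complex.I • v) = Complex.I • L v) (v w : E) :
    CBivector.map L (wedge (holPart v) (conjVec (holPart w))) =
      wedge (holPart (L v)) (conjVec (holPart (L w))) := by
  have h (α : CCotangent F) : conjCovec (α.comp L) = (conjCovec α).comp L := rfl
  refine CBivector.ext_apply fun α β => ?_
  simp only [CBivector.map_apply, wedge_apply, holPart_apply, conjVec_holPart_apply, h,
    linearPart_comp L hL]

theorem holPart_mem_holTangent (v : E) : holPart v ∈ holTangent E := by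
  intro α
  have h : Complex.I • Complex.I • v = -v := by
    rw [← mul_smul, Complex.I_mul_I, neg_one_smul]
  simp only [holPart_apply, linearPart_apply, ContinuousLinearMap.comp_apply,
    complexStructure_apply, h, map_neg]
  linear_combination (1 / 2 * α (Complex.I • v)) * Complex.I_mul_I

theorem conjVec_mem_antiholTangent {u : CTangent E} (hu : u ∈ holTangent E) :
    conjVec u ∈ antiholTangent E := by
  intro α
  have h : conjCovec (α.comp complexStructure) = (conjCovec α).comp complexStructure := rfl
  change conj (u _) = _ * conj (u _)
  rw [h, hu, map_mul, Complex.conj_I]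

theorem CBivector.IsType11.map {b : CBivector E} (hb : CBivector.IsType11 b) (L : E →L[ℝ] F)
    (hL : ∀ v, L (Complex.I • v) = Complex.I • L v) :
    CBivector.IsType11 (CBivector.map L b) := by
  have hJ (α : CCotangent F) :
      (α.comp complexStructure).comp L = (α.comp L).comp complexStructure := by
    ext v; simp [complexStructure_apply, hL]
  unfold CBivector.IsType11 at hb
  induction hb using Submodule.span_induction with
  | mem b hb =>
    obtain ⟨u, hu, w, hw, rfl⟩ := hb
    let f (u : CTangent E) : CTangent F :=
      { toFun := fun α => u (α.comp L)
        map_add' := fun α β => by rw [ContinuousLinearMap.add_comp, map_add]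
        map_smul' := fun c α => by
          rw [ContinuousLinearMap.smul_comp, LinearMap.map_smul]; rfl }
    refine Submodule.subset_span ⟨f u, fun α => ?_, f w, fun α => ?_, rfl⟩
    · exact (congrArg u (hJ α)).trans (hu _)
    · exact (congrArg w (hJ α)).trans (hw _)
  | zero => exact Submodule.zero_mem _
  | add b c _ _ hb hc => exact Submodule.add_mem _ hb hc
  | smul a b _ hb => exact Submodule.smul_mem _ a hb

/-- Bivectors of type `(1,1)` vanish on pairs of `ℂ`-linear covectors, because `(0,1)`-vectors
do. -/
theorem CBivector.IsType11.apply_eq_zero {b : CBivector E} (hb : CBivector.IsType11 b)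
    {α β : CCotangent E}
    (hα : ∀ v, α (Complex.I • v) = Complex.I * α v)
    (hβ : ∀ v, β (Complex.I • v) = Complex.I * β v) : b.1 α β = 0 := by
  have key {w : CTangent E} (hw : w ∈ antiholTangent E) {γ : CCotangent E}
      (hγ : ∀ v, γ (Complex.I • v) = Complex.I * γ v) : w γ = 0 := by
    have h := hw γ
    have h' : γ.comp complexStructure = Complex.I • γ := by
      ext v; simp [complexStructure_apply, hγ]
    rw [h', LinearMap.map_smul, smul_eq_mul] at h
    have : 2 * Complex.I * w γ = 0 := by linear_combination h
    simpa using this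
  unfold CBivector.IsType11 at hb
  induction hb using Submodule.span_induction with
  | mem b hb =>
    obtain ⟨u, hu, w, hw, rfl⟩ := hb
    simp [wedge_apply, key hw hα, key hw hβ]
  | zero => rfl
  | add b c _ _ hb hc => exact (congrArg₂ (· + ·) hb hc).trans (add_zero 0)
  | smul a b _ hb => rw [CBivector.smul_apply, hb, mul_zero]

end Type11

section HermitianForms

variable {n : ℕ} {V : Type*} [NormedAddCommGroup V] [NormedSpace ℂ V]

/-- The constant bivector `2i ∑ B_pq ξ_p ∧ ξ̄_q` on `V` defined by a Hermitian form `B` on `V^*`,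
in basis-free form: in terms of `ℂ`-linear parts of covectors. -/
noncomputable def HermitianFormDual.bivector (B : HermitianFormDual V) : CBivector V :=
  ⟨LinearMap.mk₂ ℂ (fun α β => 2 * Complex.I *
      (B.1 (linearPart α) (linearPart (conjCovec β)) -
        B.1 (linearPart β) (linearPart (conjCovec α))))
    (by intro α α' β
        simp only [linearPart_add, conjCovec_add, map_add, LinearMap.add_apply]; ring)
    (by intro c α β
        simp only [linearPart_smul, conjCovec_smul, map_smul, LinearMap.smul_apply,
          LinearMap.map_smulₛₗ, Complex.conj_conj, smul_eq_mul]; ring)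
    (by intro α β β'
        simp only [linearPart_add, conjCovec_add, map_add, LinearMap.add_apply]; ring)
    (by intro c α β
        simp only [linearPart_smul, conjCovec_smul, map_smul, LinearMap.smul_apply,
          LinearMap.map_smulₛₗ, Complex.conj_conj, smul_eq_mul]; ring),
   by intro α; simp only [LinearMap.mk₂_apply]; ring⟩

theorem HermitianFormDual.bivector_apply (B : HermitianFormDual V) (α β : CCotangent V) :
    B.bivector.1 α β = 2 * Complex.I *
      (B.1 (linearPart α) (linearPart (conjCovec β)) -
        B.1 (linearPart β) (linearPart (conjCovec α))) := rfl

theorem HermitianFormDual.apply_eq_sum (B : HermitianFormDual V) (ξ : Module.Basis (Fin n) ℂ V)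
    (f g : Module.Dual ℂ V) :
    B.1 f g = ∑ p, ∑ q, B.matrix ξ p q * (f (ξ p) * conj (g (ξ q))) := by
  conv_lhs => rw [← ξ.sum_dual_apply_smul_coord f, ← ξ.sum_dual_apply_smul_coord g]
  simp only [map_sum, LinearMap.sum_apply, map_smul, LinearMap.map_smulₛₗ, LinearMap.smul_apply,
    smul_eq_mul, HermitianFormDual.matrix, Finset.mul_sum]
  rw [Finset.sum_comm]
  refine Finset.sum_congr rfl fun p _ => Finset.sum_congr rfl fun q _ => ?_
  ring

theorem HermitianFormDual.bivector_eq_sum (B : HermitianFormDual V)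
    (ξ : Module.Basis (Fin n) ℂ V) :
    B.bivector = (2 * Complex.I) • ∑ p, ∑ q, B.matrix ξ p q •
      wedge (holPart (ξ p)) (conjVec (holPart (ξ q))) := by
  refine CBivector.ext_apply fun α β => ?_
  simp only [CBivector.smul_apply, CBivector.sum_apply, wedge_apply, holPart_apply,
    conjVec_holPart_apply, HermitianFormDual.bivector_apply, B.apply_eq_sum ξ,
    ← Finset.sum_sub_distrib, ← mul_sub]

theorem HermitianFormDual.bivector_isReal (B : HermitianFormDual V) :
    CBivector.IsReal B.bivector := by
  intro α β
  simp only [HermitianFormDual.bivector_apply, conjCovec_conjCovec, map_mul, map_sub,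
    ← B.2, Complex.conj_I, map_ofNat]
  ring

theorem HermitianFormDual.bivector_isType11 (B : HermitianFormDual V)
    (ξ : Module.Basis (Fin n) ℂ V) : CBivector.IsType11 B.bivector := by
  rw [B.bivector_eq_sum ξ]
  exact Submodule.smul_mem _ _ <| Submodule.sum_mem _ fun p _ => Submodule.sum_mem _ fun q _ =>
    Submodule.smul_mem _ _ <| Submodule.subset_span
      ⟨_, holPart_mem_holTangent _, _, conjVec_mem_antiholTangent (holPart_mem_holTangent _), rfl⟩

variable [FiniteDimensional ℂ V]

/-- A `ℂ`-linear form on `V`, as a complex covector. -/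
noncomputable def dualToCovec (f : Module.Dual ℂ V) : CCotangent V :=
  (LinearMap.toContinuousLinearMap f).restrictScalars ℝ

theorem dualToCovec_apply (f : Module.Dual ℂ V) (v : V) : dualToCovec f v = f v := rfl

theorem linearPart_dualToCovec (f : Module.Dual ℂ V) : linearPart (dualToCovec f) = f := by
  ext v
  simp only [linearPart_apply, dualToCovec_apply, map_smul, smul_eq_mul]
  linear_combination (-(1 / 2 : ℂ) * f v) * Complex.I_mul_I

theorem linearPart_conjCovec_dualToCovec (f : Module.Dual ℂ V) :
    linearPart (conjCovec (dualToCovec f)) = 0 := by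
  ext v
  simp only [linearPart_apply, conjCovec_apply, dualToCovec_apply, map_smul, smul_eq_mul, map_mul,
    Complex.conj_I, LinearMap.zero_apply]
  linear_combination ((1 / 2 : ℂ) * conj (f v)) * Complex.I_mul_I

/-- The decomposition of a covector into its `ℂ`-linear and antilinear parts. -/
theorem covec_eq_linearPart_add (α : CCotangent V) :
    α = dualToCovec (linearPart α) + conjCovec (dualToCovec (linearPart (conjCovec α))) := by
  ext v
  simp only [add_apply, conjCovec_apply, dualToCovec_apply, linearPart_apply,
    map_mul, map_sub, Complex.conj_conj, Complex.conj_I, map_div₀, map_one, map_ofNat]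
  ring

theorem HermitianFormDual.bivector_injective :
    Function.Injective (HermitianFormDual.bivector (V := V)) := by
  intro B C h
  apply Subtype.ext
  ext f g
  have h1 := congrArg (fun b : CBivector V =>
    b.1 (dualToCovec f) (conjCovec (dualToCovec g))) h
  simpa [HermitianFormDual.bivector_apply, conjCovec_conjCovec, linearPart_dualToCovec,
    linearPart_conjCovec_dualToCovec] using h1

/-- Every real bivector of type `(1,1)` on `V` comes from a Hermitian form: the `(2,0)` and `(0,2)`
parts of the bivector vanish, and its values on a linear and an antilinear covector define `B`. -/
theorem HermitianFormDual.exists_bivector_eq {b : CBivector V} (hr : CBivector.IsReal b)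
    (ht : CBivector.IsType11 b) : ∃ B : HermitianFormDual V, B.bivector = b := by
  have hadd (f g : Module.Dual ℂ V) : dualToCovec (f + g) = dualToCovec f + dualToCovec g := rfl
  have hsmul (c : ℂ) (f : Module.Dual ℂ V) : dualToCovec (c • f) = c • dualToCovec f := rfl
  have hI : (2 * Complex.I : ℂ) ≠ 0 := by simp
  have hlin (f : Module.Dual ℂ V) (v : V) :
      dualToCovec f (Complex.I • v) = Complex.I * dualToCovec f v := f.map_smul _ _
  have h20 (f g : Module.Dual ℂ V) : b.1 (dualToCovec f) (dualToCovec g) = 0 :=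
    CBivector.IsType11.apply_eq_zero ht (hlin f) (hlin g)
  have h02 (f g : Module.Dual ℂ V) :
      b.1 (conjCovec (dualToCovec f)) (conjCovec (dualToCovec g)) = 0 := by
    rw [← hr, conjCovec_conjCovec, conjCovec_conjCovec, h20, map_zero]
  let B : Module.Dual ℂ V →ₗ[ℂ] Module.Dual ℂ V →ₗ⋆[ℂ] ℂ :=
    LinearMap.mk₂'ₛₗ (RingHom.id ℂ) (starRingEnd ℂ)
      (fun f g => (2 * Complex.I)⁻¹ * b.1 (dualToCovec f) (conjCovec (dualToCovec g)))
      (fun f f' g => by simp only [hadd, map_add, LinearMap.add_apply, mul_add])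
      (fun c f g => by
        simp only [hsmul, map_smul, LinearMap.smul_apply, smul_eq_mul, RingHom.id_apply]; ring)
      (fun f g g' => by simp only [hadd, conjCovec_add, map_add, mul_add])
      (fun c f g => by
        simp only [hsmul, conjCovec_smul, map_smul, smul_eq_mul]; ring)
  have hB (f g : Module.Dual ℂ V) :
      B f g = (2 * Complex.I)⁻¹ * b.1 (dualToCovec f) (conjCovec (dualToCovec g)) := rfl
  have herm (f g : Module.Dual ℂ V) : B g f = conj (B f g) := by
    have h := hr (conjCovec (dualToCovec f)) (dualToCovec g)
    rw [conjCovec_conjCovec] at h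
    rw [hB, hB, map_mul, h, CBivector.swap b, map_inv₀, map_mul, Complex.conj_I, map_ofNat]
    ring
  refine ⟨⟨B, herm⟩, CBivector.ext_apply fun α β => ?_⟩
  change 2 * Complex.I * (B (linearPart α) (linearPart (conjCovec β)) -
    B (linearPart β) (linearPart (conjCovec α))) = _
  conv_rhs => rw [covec_eq_linearPart_add α, covec_eq_linearPart_add β]
  simp only [map_add, LinearMap.add_apply, h20, h02, hB]
  rw [CBivector.swap b (conjCovec (dualToCovec (linearPart (conjCovec α)))), ← mul_sub,
    mul_inv_cancel_left₀ hI]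
  ring

end HermitianForms

/-! ### Complex manifolds as real manifolds -/

section RestrictScalars

variable {E F : Type*} [NormedAddCommGroup E] [NormedSpace ℝ E] [NormedSpace ℂ E]
  [IsScalarTower ℝ ℂ E] [NormedAddCommGroup F] [NormedSpace ℝ F] [NormedSpace ℂ F]
  [IsScalarTower ℝ ℂ F] {M N : Type*} [TopologicalSpace M] [TopologicalSpace N]

theorem HasMFDerivAt.complexToReal [ChartedSpace E M] [ChartedSpace F N] {f : M → N} {x : M}
    {f' : E →L[ℂ] F} (h : HasMFDerivAt 𝓘(ℂ, E) 𝓘(ℂ, F) f x f') :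
    HasMFDerivAt 𝓘(ℝ, E) 𝓘(ℝ, F) f x (f'.restrictScalars ℝ : E →L[ℝ] F) :=
  ⟨h.1, HasFDerivWithinAt.restrictScalars ℝ h.2⟩

theorem ContMDiffWithinAt.complexToReal {H H' : Type*} [TopologicalSpace H] [TopologicalSpace H']
    [ChartedSpace H M] [ChartedSpace H' N] {I : ModelWithCorners ℂ E H}
    {J : ModelWithCorners ℂ F H'} {I' : ModelWithCorners ℝ E H} {J' : ModelWithCorners ℝ F H'}
    (hI : ⇑I = I') (hI' : ⇑I.symm = I'.symm) (hJ : ⇑J = J') {k : ℕ∞ω} {f : M → N} {s : Set M}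
    {x : M} (h : ContMDiffWithinAt I J k f s x) : ContMDiffWithinAt I' J' k f s x := by
  refine ⟨h.1, ?_⟩
  have h2 := ContDiffWithinAt.restrict_scalars ℝ h.2
  rw [hI, hI', hJ] at h2
  exact h2

theorem IsManifold.complexToReal (k : ℕ∞ω) [ChartedSpace E M] [IsManifold 𝓘(ℂ, E) k M] :
    IsManifold 𝓘(ℝ, E) k M := by
  refine isManifold_of_contDiffOn _ _ _ fun e e' he he' => ?_
  have h := (contDiffGroupoid k 𝓘(ℂ, E)).compatible he he'
  rw [contDiffGroupoid, mem_groupoid_of_pregroupoid] at h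
  exact ContDiffOn.restrict_scalars ℝ h.1

end RestrictScalars

theorem HasMFDerivAt.comp_of_eq {E F G M N P : Type*} [NormedAddCommGroup E] [NormedSpace ℝ E]
    [NormedAddCommGroup F] [NormedSpace ℝ F] [NormedAddCommGroup G] [NormedSpace ℝ G]
    [TopologicalSpace M] [ChartedSpace E M] [TopologicalSpace N] [ChartedSpace F N]
    [TopologicalSpace P] [ChartedSpace G P] {g : N → P} {f : M → N} {x : M} {y : N}
    {g' : F →L[ℝ] G} {f' : E →L[ℝ] F} (hg : HasMFDerivAt 𝓘(ℝ, F) 𝓘(ℝ, G) g y g')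
    (hf : HasMFDerivAt 𝓘(ℝ, E) 𝓘(ℝ, F) f x f') (hy : f x = y) :
    HasMFDerivAt 𝓘(ℝ, E) 𝓘(ℝ, G) (g ∘ f) x (g'.comp f' : E →L[ℝ] G) := by
  subst hy
  exact HasMFDerivAt.comp x hg hf

/-! ### Orbit maps -/

section ExpAct

variable {V : Type*} [NormedAddCommGroup V] {Λ : AddSubgroup V} {M : Type*} [AddAction (V ⧸ Λ) M]

theorem expAct_add (v w : V) (x : M) : expAct Λ (v + w) x = expAct Λ v (expAct Λ w x) :=
  add_vadd (v : V ⧸ Λ) (w : V ⧸ Λ) x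

theorem expAct_zero (x : M) : expAct Λ 0 x = x :=
  zero_vadd (V ⧸ Λ) x

theorem exists_expAct_eq (t : V ⧸ Λ) : ∃ v : V, ∀ x : M, t +ᵥ x = expAct Λ v x := by
  obtain ⟨v, rfl⟩ := QuotientAddGroup.mk_surjective t
  exact ⟨v, fun x => rfl⟩

end ExpAct

section Orbit

variable {n : ℕ} {V : Type*} [NormedAddCommGroup V] [NormedSpace ℂ V] {Λ : AddSubgroup V}
  {M : Type*} [TopologicalSpace M] [ChartedSpace (Fin n → ℂ) M] [AddAction (V ⧸ Λ) M]

variable (n Λ) in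
/-- The differential at `0` of the orbit map `v ↦ exp(v) · x`, as a real-linear map. -/
noncomputable def orbitDeriv (x : M) : V →L[ℝ] (Fin n → ℂ) :=
  (mfderiv 𝓘(ℂ, V) 𝓘(ℂ, Fin n → ℂ) (fun v : V => expAct Λ v x) 0 :
    V →L[ℂ] (Fin n → ℂ)).restrictScalars ℝ

theorem orbitDeriv_complex_smul (x : M) (c : ℂ) (ξ : V) :
    orbitDeriv n Λ x (c • ξ) = c • orbitDeriv n Λ x ξ :=
  map_smul (mfderiv 𝓘(ℂ, V) 𝓘(ℂ, Fin n → ℂ) (fun v : V => expAct Λ v x) 0 :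
    V →L[ℂ] (Fin n → ℂ)) c ξ

namespace IsComplexToricManifold

theorem contMDiff_expAct (hM : IsComplexToricManifold n Λ M) :
    ContMDiff (𝓘(ℝ, V).prod 𝓘(ℝ, Fin n → ℂ)) 𝓘(ℝ, Fin n → ℂ) ω
      (fun p : V × M => expAct Λ p.1 p.2) :=
  fun p => ContMDiffWithinAt.complexToReal rfl rfl rfl (hM.holomorphic p)

theorem contMDiff_expAct_left (hM : IsComplexToricManifold n Λ M) (v : V) :
    ContMDiff 𝓘(ℝ, Fin n → ℂ) 𝓘(ℝ, Fin n → ℂ) ω (fun x : M => expAct Λ v x) :=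
  hM.contMDiff_expAct.comp (contMDiff_const.prodMk contMDiff_id)

theorem contMDiff_orbit (hM : IsComplexToricManifold n Λ M) (x : M) :
    ContMDiff 𝓘(ℝ, V) 𝓘(ℝ, Fin n → ℂ) ω (fun v : V => expAct Λ v x) :=
  hM.contMDiff_expAct.comp (contMDiff_id.prodMk contMDiff_const)

theorem contMDiff_orbit_complex (hM : IsComplexToricManifold n Λ M) (x : M) :
    ContMDiff 𝓘(ℂ, V) 𝓘(ℂ, Fin n → ℂ) ω (fun v : V => expAct Λ v x) :=
  hM.holomorphic.comp (contMDiff_id.prodMk contMDiff_const)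

theorem hasMFDerivAt_orbit_zero (hM : IsComplexToricManifold n Λ M) (x : M) :
    HasMFDerivAt 𝓘(ℝ, V) 𝓘(ℝ, Fin n → ℂ) (fun v : V => expAct Λ v x) 0
      (orbitDeriv n Λ x : V →L[ℝ] (Fin n → ℂ)) :=
  HasMFDerivAt.complexToReal
    ((hM.contMDiff_orbit_complex x).mdifferentiableAt (by simp)).hasMFDerivAt

/-- The differential of the orbit map of `x` at `v` is that of the orbit map of `exp(v) · x`
at `0`. -/
theorem hasMFDerivAt_orbit (hM : IsComplexToricManifold n Λ M) (x : M) (v : V) :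
    HasMFDerivAt 𝓘(ℝ, V) 𝓘(ℝ, Fin n → ℂ) (fun w : V => expAct Λ w x) v
      (orbitDeriv n Λ (expAct Λ v x) : V →L[ℝ] (Fin n → ℂ)) := by
  have h1 : HasMFDerivAt 𝓘(ℝ, V) 𝓘(ℝ, V) (fun w : V => w - v) v (ContinuousLinearMap.id ℝ V) :=
    ((hasFDerivAt_id v).sub_const v).hasMFDerivAt
  have h2 := HasMFDerivAt.comp_of_eq (hM.hasMFDerivAt_orbit_zero (expAct Λ v x)) h1 (sub_self v)
  have h3 : (fun w : V => expAct Λ w x) =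
      (fun w : V => expAct Λ w (expAct Λ v x)) ∘ fun w => w - v := by
    ext w
    simp [← expAct_add]
  rw [h3]
  exact h2

/-- The derivative along the torus action of a function on `M`. -/
theorem hasFDerivAt_comp_orbit (hM : IsComplexToricManifold n Λ M) {F : Type*}
    [NormedAddCommGroup F] [NormedSpace ℝ F] {g : M → F} {x : M} {v : V}
    (hg : MDifferentiableAt 𝓘(ℝ, Fin n → ℂ) 𝓘(ℝ, F) g (expAct Λ v x)) :
    HasFDerivAt (fun w : V => g (expAct Λ w x))
      ((mfderiv 𝓘(ℝ, Fin n → ℂ) 𝓘(ℝ, F) g (expAct Λ v x) : (Fin n → ℂ) →L[ℝ] F).comp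
        (orbitDeriv n Λ (expAct Λ v x))) v :=
  hasMFDerivAt_iff_hasFDerivAt.1 (hg.hasMFDerivAt.comp v (hM.hasMFDerivAt_orbit x v))

theorem hasFDerivAt_comp_orbit_zero (hM : IsComplexToricManifold n Λ M) {F : Type*}
    [NormedAddCommGroup F] [NormedSpace ℝ F] {g : M → F} {x : M}
    (hg : MDifferentiableAt 𝓘(ℝ, Fin n → ℂ) 𝓘(ℝ, F) g x) :
    HasFDerivAt (fun w : V => g (expAct Λ w x))
      ((mfderiv 𝓘(ℝ, Fin n → ℂ) 𝓘(ℝ, F) g x : (Fin n → ℂ) →L[ℝ] F).comp (orbitDeriv n Λ x)) 0 :=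
  hasMFDerivAt_iff_hasFDerivAt.1
    (HasMFDerivAt.comp_of_eq hg.hasMFDerivAt (hM.hasMFDerivAt_orbit_zero x) (expAct_zero x))

/-- Generated vector fields are invariant under the torus action, because the torus is
commutative. -/
theorem realDeriv_vadd_comp_orbitDeriv (hM : IsComplexToricManifold n Λ M) (t : V ⧸ Λ) (x : M) :
    (realDeriv (fun y : M => t +ᵥ y) x).comp (orbitDeriv n Λ x) = orbitDeriv n Λ (t +ᵥ x) := by
  obtain ⟨v, hv⟩ := exists_expAct_eq (M := M) t
  simp only [hv]
  have h1 : MDifferentiableAt 𝓘(ℝ, Fin n → ℂ) 𝓘(ℝ, Fin n → ℂ) (fun y : M => expAct Λ v y) x :=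
    (hM.contMDiff_expAct_left v).mdifferentiableAt (by simp)
  have h2 := HasMFDerivAt.comp_of_eq h1.hasMFDerivAt (hM.hasMFDerivAt_orbit_zero x) (expAct_zero x)
  have h3 : (fun y : M => expAct Λ v y) ∘ (fun w : V => expAct Λ w x) =
      fun w : V => expAct Λ w (expAct Λ v x) := by
    ext w
    simp only [Function.comp_apply, ← expAct_add, add_comm v w]
  rw [h3] at h2
  exact hasMFDerivAt_unique h2 (hM.hasMFDerivAt_orbit_zero _)

end IsComplexToricManifold

end Orbit

/-! ### The Jacobi identity for constant bivectors -/

section ConstantJacobi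

variable {V : Type*} [NormedAddCommGroup V] [NormedSpace ℝ V] [FiniteDimensional ℝ V]

/-- On a finite-dimensional space the complex dual of the covectors is spanned by evaluations. -/
theorem CTangent.eq_sum_basis {ι : Type*} [Fintype ι] (b : Module.Basis ι ℝ V) (u : CTangent V) :
    ∃ c : ι → ℂ, ∀ γ : CCotangent V, u γ = ∑ a, c a * γ (b a) := by
  let e (a : ι) : CCotangent V :=
    Complex.ofRealCLM.comp (LinearMap.toContinuousLinearMap (b.coord a))
  refine ⟨fun a => u (e a), fun γ => ?_⟩
  have h : γ = ∑ a, γ (b a) • e a := by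
    ext v
    calc γ v = γ (∑ a, b.repr v a • b a) := by rw [b.sum_repr]
      _ = _ := by
        simp only [map_sum, map_smul]
        simp [e, mul_comm]
  conv_lhs => rw [h]
  simp [mul_comm]

/-- The algebraic core of the Jacobi identity: `F`, `G`, `H` are the (symmetric) Hessians of
functions with differentials `α`, `β`, `γ`, and `δ₁`, `δ₂`, `δ₃` are the differentials of their
brackets with respect to the constant bivector `P`. -/
theorem CBivector.jacobi_of_symmetric (P : CBivector V) {α β γ δ₁ δ₂ δ₃ : CCotangent V}
    {F G H : V →L[ℝ] CCotangent V} (hF : ∀ v w, F v w = F w v) (hG : ∀ v w, G v w = G w v)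
    (hH : ∀ v w, H v w = H w v) (h₁ : ∀ w, δ₁ w = P.1 (G w) γ + P.1 β (H w))
    (h₂ : ∀ w, δ₂ w = P.1 (H w) α + P.1 γ (F w))
    (h₃ : ∀ w, δ₃ w = P.1 (F w) β + P.1 α (G w)) :
    P.1 α δ₁ + P.1 β δ₂ + P.1 γ δ₃ = 0 := by
  let b := Module.finBasis ℝ V
  obtain ⟨p, hp⟩ := CTangent.eq_sum_basis b (P.1 α)
  obtain ⟨q, hq⟩ := CTangent.eq_sum_basis b (P.1 β)
  obtain ⟨r, hr⟩ := CTangent.eq_sum_basis b (P.1 γ)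
  -- the complex bilinear extension of a Hessian, evaluated at two complex vectors
  let S (K : V →L[ℝ] CCotangent V) (c d : Fin (Module.finrank ℝ V) → ℂ) : ℂ :=
    ∑ i, ∑ j, c i * (d j * K (b i) (b j))
  have hS {K : V →L[ℝ] CCotangent V} (hK : ∀ v w, K v w = K w v)
      (c d : Fin (Module.finrank ℝ V) → ℂ) : S K c d = S K d c := by
    simp only [S]
    rw [Finset.sum_comm]
    refine Finset.sum_congr rfl fun i _ => Finset.sum_congr rfl fun j _ => ?_
    rw [hK]
    ring
  have e₁ : P.1 α δ₁ = S H p q - S G p r := by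
    simp only [hp, h₁, CBivector.swap P _ γ, hr, hq, S, mul_add, Finset.sum_add_distrib,
      Finset.mul_sum, mul_neg, Finset.sum_neg_distrib]
    ring
  have e₂ : P.1 β δ₂ = S F q r - S H q p := by
    simp only [hq, h₂, CBivector.swap P _ α, hp, hr, S, mul_add, Finset.sum_add_distrib,
      Finset.mul_sum, mul_neg, Finset.sum_neg_distrib]
    ring
  have e₃ : P.1 γ δ₃ = S G r p - S F r q := by
    simp only [hr, h₃, CBivector.swap P _ β, hp, hq, S, mul_add, Finset.sum_add_distrib,
      Finset.mul_sum, mul_neg, Finset.sum_neg_distrib]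
    ring
  rw [e₁, e₂, e₃, hS hF q r, hS hG p r, hS hH p q]
  ring

/-- A bivector as a continuous real bilinear map. -/
noncomputable def CBivector.toCLM (P : CBivector V) :
    CCotangent V →L[ℝ] CCotangent V →L[ℝ] ℂ :=
  LinearMap.toContinuousLinearMap
    { toFun := fun α => LinearMap.toContinuousLinearMap ((P.1 α).restrictScalars ℝ)
      map_add' := fun α β => by ext γ; simp
      map_smul' := fun c α => by
        ext γ
        have h : c • α = (c : ℂ) • α := by ext; simp
        simp [h] }

theorem CBivector.toCLM_apply (P : CBivector V) (α β : CCotangent V) :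
    CBivector.toCLM P α β = P.1 α β := rfl

end ConstantJacobi

/-! ### Poisson structures induced by constant bivectors on the Lie algebra -/

section OrbitBivector

variable {n : ℕ} {V : Type*} [NormedAddCommGroup V] [NormedSpace ℂ V] {Λ : AddSubgroup V}
  {M : Type*} [TopologicalSpace M] [ChartedSpace (Fin n → ℂ) M] [AddAction (V ⧸ Λ) M]

variable (n Λ M) in
/-- The bivector field on `M` induced by a constant bivector `P` on the Lie algebra `V`: its value
at `x` is the push-forward of `P` under the differential of the orbit map. -/
noncomputable def orbitBivector (P : CBivector V) : BivectorField n M :=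
  fun x => CBivector.map (orbitDeriv n Λ x) P

variable (n Λ) in
/-- The differential of a function on `M` along the orbits: the pull-back of its differential under
the differential of the orbit map. -/
noncomputable def torusDeriv {F : Type*} [NormedAddCommGroup F] [NormedSpace ℝ F] (g : M → F)
    (x : M) : V →L[ℝ] F :=
  ContinuousLinearMap.comp (M₂ := Fin n → ℂ) (mfderiv 𝓘(ℝ, Fin n → ℂ) 𝓘(ℝ, F) g x)
    (orbitDeriv n Λ x)

theorem bracket_orbitBivector (P : CBivector V) (g h : M → ℂ) (x : M) :
    BivectorField.bracket (orbitBivector n Λ M P) g h x =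
      P.1 (torusDeriv n Λ g x) (torusDeriv n Λ h x) := rfl

namespace IsComplexToricManifold

theorem torusDeriv_expAct (hM : IsComplexToricManifold n Λ M) {F : Type*}
    [NormedAddCommGroup F] [NormedSpace ℝ F] {g : M → F} {x : M} {v : V}
    (hg : MDifferentiableAt 𝓘(ℝ, Fin n → ℂ) 𝓘(ℝ, F) g (expAct Λ v x)) :
    torusDeriv n Λ g (expAct Λ v x) = fderiv ℝ (fun w : V => g (expAct Λ w x)) v := by
  have h : HasFDerivAt (fun w : V => g (expAct Λ w x)) (torusDeriv n Λ g (expAct Λ v x)) v :=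
    hM.hasFDerivAt_comp_orbit hg
  exact h.fderiv.symm

theorem torusDeriv_eq (hM : IsComplexToricManifold n Λ M) {F : Type*}
    [NormedAddCommGroup F] [NormedSpace ℝ F] {g : M → F} {x : M}
    (hg : MDifferentiableAt 𝓘(ℝ, Fin n → ℂ) 𝓘(ℝ, F) g x) :
    torusDeriv n Λ g x = fderiv ℝ (fun w : V => g (expAct Λ w x)) 0 := by
  have h : HasFDerivAt (fun w : V => g (expAct Λ w x)) (torusDeriv n Λ g x) 0 :=
    hM.hasFDerivAt_comp_orbit_zero hg
  exact h.fderiv.symm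


theorem orbitBivector_isToric (hM : IsComplexToricManifold n Λ M) (P : CBivector V) :
    BivectorField.IsToric Λ (orbitBivector n Λ M P) := fun t x => by
  rw [orbitBivector, CBivector.map_map, hM.realDeriv_vadd_comp_orbitDeriv]
  rfl

/-- Differentiating a smooth function along the torus action gives a smooth function. -/
theorem contMDiffAt_fderiv_comp_orbit [IsManifold 𝓘(ℝ, Fin n → ℂ) ∞ M]
    (hM : IsComplexToricManifold n Λ M) {F : Type*} [NormedAddCommGroup F] [NormedSpace ℝ F]
    {g : M → F} {x : M} (hg : ContMDiffAt 𝓘(ℝ, Fin n → ℂ) 𝓘(ℝ, F) ∞ g x) :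
    ContMDiffAt 𝓘(ℝ, Fin n → ℂ) 𝓘(ℝ, V →L[ℝ] F) ∞
      (fun y => fderiv ℝ (fun v : V => g (expAct Λ v y)) 0) x := by
  set c := chartAt (Fin n → ℂ) x
  have hx : x ∈ c.source := mem_chart_source _ x
  have hc : ContMDiffAt 𝓘(ℝ, Fin n → ℂ) 𝓘(ℝ, Fin n → ℂ) ∞ c x :=
    contMDiffAt_of_mem_maximalAtlas (IsManifold.chart_mem_maximalAtlas x) hx
  have hs : ContMDiffAt 𝓘(ℝ, Fin n → ℂ) 𝓘(ℝ, Fin n → ℂ) ∞ c.symm (c x) :=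
    contMDiffAt_symm_of_mem_maximalAtlas (IsManifold.chart_mem_maximalAtlas x)
      (c.map_source hx)
  let G (z : Fin n → ℂ) (v : V) : F := g (expAct Λ v (c.symm z))
  have hG : ContMDiffAt (𝓘(ℝ, Fin n → ℂ).prod 𝓘(ℝ, V)) 𝓘(ℝ, F) ∞
      (Function.uncurry G) (c x, (0 : V)) := by
    have h1 : ContMDiffAt (𝓘(ℝ, Fin n → ℂ).prod 𝓘(ℝ, V)) 𝓘(ℝ, Fin n → ℂ) ∞
        (fun p : (Fin n → ℂ) × V => c.symm p.1) (c x, (0 : V)) :=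
      ContMDiffAt.comp (c x, (0 : V)) hs contMDiffAt_fst
    have h2 := ContMDiffAt.comp (c x, (0 : V))
      ((hM.contMDiff_expAct.of_le le_top).contMDiffAt (x := ((0 : V), c.symm (c x))))
      (contMDiffAt_snd.prodMk h1)
    refine ContMDiffAt.comp_of_eq hg h2 ?_
    simp [expAct_zero, c.left_inv hx]
  rw [← modelWithCornersSelf_prod, chartedSpaceSelf_prod, contMDiffAt_iff_contDiffAt] at hG
  have h3 : ContDiffAt ℝ ∞ (fun z => fderiv ℝ (G z) 0) (c x) :=
    ContDiffAt.fderiv hG contDiffAt_const le_rfl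
  refine (h3.contMDiffAt.comp x hc).congr_of_eventuallyEq ?_
  filter_upwards [c.open_source.mem_nhds hx] with y hy
  simp only [Function.comp_apply, G, c.left_inv hy]

theorem contDiffAt_comp_orbit (hM : IsComplexToricManifold n Λ M) {F : Type*}
    [NormedAddCommGroup F] [NormedSpace ℝ F] {g : M → F} {x : M}
    (hg : ContMDiffAt 𝓘(ℝ, Fin n → ℂ) 𝓘(ℝ, F) ∞ g x) :
    ContDiffAt ℝ ∞ (fun v : V => g (expAct Λ v x)) 0 :=
  contMDiffAt_iff_contDiffAt.1
    (ContMDiffAt.comp_of_eq hg ((hM.contMDiff_orbit x).of_le le_top).contMDiffAt (expAct_zero x))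

theorem contMDiffAt_torusDeriv [IsManifold 𝓘(ℝ, Fin n → ℂ) ∞ M]
    (hM : IsComplexToricManifold n Λ M) {F : Type*} [NormedAddCommGroup F] [NormedSpace ℝ F]
    {g : M → F} {U : Set M} (hU : IsOpen U) {x : M} (hx : x ∈ U)
    (hg : ContMDiffOn 𝓘(ℝ, Fin n → ℂ) 𝓘(ℝ, F) ∞ g U) :
    ContMDiffAt 𝓘(ℝ, Fin n → ℂ) 𝓘(ℝ, V →L[ℝ] F) ∞
      (torusDeriv n Λ g) x := by
  refine (hM.contMDiffAt_fderiv_comp_orbit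
    (hg.contMDiffAt (hU.mem_nhds hx))).congr_of_eventuallyEq ?_
  filter_upwards [hU.mem_nhds hx] with y hy
  exact hM.torusDeriv_eq ((hg.contMDiffAt (hU.mem_nhds hy)).mdifferentiableAt (by simp))

variable [FiniteDimensional ℝ V]

theorem orbitBivector_isSmooth [IsManifold 𝓘(ℝ, Fin n → ℂ) ∞ M]
    (hM : IsComplexToricManifold n Λ M) (P : CBivector V) :
    BivectorField.IsSmooth (orbitBivector n Λ M P) := by
  intro c hc α β x hx
  have h := hM.contMDiffAt_torusDeriv c.open_source hx
    (contMDiffOn_of_mem_maximalAtlas (IsManifold.subset_maximalAtlas hc))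
  have h2 : ContDiff ℝ ∞ (fun L : V →L[ℝ] (Fin n → ℂ) =>
      CBivector.toCLM P (α.comp L) (β.comp L)) := by fun_prop
  exact (h2.contDiffAt.contMDiffAt.comp x h).contMDiffWithinAt

theorem contMDiffAt_bracket_orbitBivector [IsManifold 𝓘(ℝ, Fin n → ℂ) ∞ M]
    (hM : IsComplexToricManifold n Λ M) (P : CBivector V) {U : Set M} (hU : IsOpen U) {x : M}
    (hx : x ∈ U) {g h : M → ℂ} (hg : ContMDiffOn 𝓘(ℝ, Fin n → ℂ) 𝓘(ℝ, ℂ) ∞ g U)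
    (hh : ContMDiffOn 𝓘(ℝ, Fin n → ℂ) 𝓘(ℝ, ℂ) ∞ h U) :
    ContMDiffAt 𝓘(ℝ, Fin n → ℂ) 𝓘(ℝ, ℂ) ∞
      (BivectorField.bracket (orbitBivector n Λ M P) g h) x := by
  have h2 : ContDiff ℝ ∞ (fun p : (V →L[ℝ] ℂ) × (V →L[ℝ] ℂ) =>
      CBivector.toCLM P p.1 p.2) := by fun_prop
  exact h2.contDiffAt.contMDiffAt.comp x
    ((hM.contMDiffAt_torusDeriv hU hx hg).prodMk_space
      (hM.contMDiffAt_torusDeriv hU hx hh))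

/-- The differential of a bracket along the orbits, in terms of the Hessians of the pull-backs of
the two functions under the orbit map. -/
theorem torusDeriv_bracket_apply [IsManifold 𝓘(ℝ, Fin n → ℂ) ∞ M]
    (hM : IsComplexToricManifold n Λ M) (P : CBivector V) {U : Set M} (hU : IsOpen U) {x : M}
    (hx : x ∈ U) {g h : M → ℂ} (hg : ContMDiffOn 𝓘(ℝ, Fin n → ℂ) 𝓘(ℝ, ℂ) ∞ g U)
    (hh : ContMDiffOn 𝓘(ℝ, Fin n → ℂ) 𝓘(ℝ, ℂ) ∞ h U) (w : V) :
    torusDeriv n Λ (BivectorField.bracket (orbitBivector n Λ M P) g h) x w =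
      P.1 (fderiv ℝ (fderiv ℝ fun v : V => g (expAct Λ v x)) 0 w) (torusDeriv n Λ h x) +
        P.1 (torusDeriv n Λ g x) (fderiv ℝ (fderiv ℝ fun v : V => h (expAct Λ v x)) 0 w) := by
  have hmd {k : M → ℂ} (hk : ContMDiffOn 𝓘(ℝ, Fin n → ℂ) 𝓘(ℝ, ℂ) ∞ k U) {y : M} (hy : y ∈ U) :
      MDifferentiableAt 𝓘(ℝ, Fin n → ℂ) 𝓘(ℝ, ℂ) k y :=
    (hk.contMDiffAt (hU.mem_nhds hy)).mdifferentiableAt (by simp)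
  have hd {k : M → ℂ} (hk : ContMDiffOn 𝓘(ℝ, Fin n → ℂ) 𝓘(ℝ, ℂ) ∞ k U) :
      DifferentiableAt ℝ (fderiv ℝ fun v : V => k (expAct Λ v x)) 0 :=
    ((hM.contDiffAt_comp_orbit (hk.contMDiffAt (hU.mem_nhds hx))).fderiv_right
      (m := 1) (by norm_cast)).differentiableAt (by simp)
  have hev : ∀ᶠ v in 𝓝 (0 : V), expAct Λ v x ∈ U := by
    refine (hM.contMDiff_orbit x).continuous.continuousAt.eventually_mem ?_
    rw [expAct_zero]
    exact hU.mem_nhds hx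
  have hloc : (fun v : V => BivectorField.bracket (orbitBivector n Λ M P) g h (expAct Λ v x))
      =ᶠ[𝓝 0] fun v => CBivector.toCLM P (fderiv ℝ (fun w : V => g (expAct Λ w x)) v)
        (fderiv ℝ (fun w : V => h (expAct Λ w x)) v) := by
    filter_upwards [hev] with v hv
    rw [bracket_orbitBivector, hM.torusDeriv_expAct (hmd hg hv), hM.torusDeriv_expAct (hmd hh hv)]
    rfl
  rw [hM.torusDeriv_eq ((hM.contMDiffAt_bracket_orbitBivector P hU hx hg hh).mdifferentiableAt
    (by simp)), hloc.fderiv_eq, hM.torusDeriv_eq (hmd hg hx), hM.torusDeriv_eq (hmd hh hx),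
    ((CBivector.toCLM P).hasFDerivAt_of_bilinear (hd hg).hasFDerivAt (hd hh).hasFDerivAt).fderiv]
  simp [CBivector.toCLM_apply, add_comm]

theorem orbitBivector_isPoisson [IsManifold 𝓘(ℝ, Fin n → ℂ) ∞ M]
    (hM : IsComplexToricManifold n Λ M) (P : CBivector V) :
    BivectorField.IsPoisson (orbitBivector n Λ M P) := by
  refine ⟨hM.orbitBivector_isSmooth P, fun U hU f g h hf hg hh x hx => ?_⟩
  have hsymm {k : M → ℂ} (hk : ContMDiffOn 𝓘(ℝ, Fin n → ℂ) 𝓘(ℝ, ℂ) ∞ k U) :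
      IsSymmSndFDerivAt ℝ (fun v : V => k (expAct Λ v x)) 0 :=
    (hM.contDiffAt_comp_orbit (hk.contMDiffAt (hU.mem_nhds hx))).isSymmSndFDerivAt
      (by simpa using WithTop.coe_le_coe.2 (le_top : (2 : ℕ∞) ≤ ⊤))
  simp only [bracket_orbitBivector (Λ := Λ) P _ _ x]
  exact CBivector.jacobi_of_symmetric P (hsymm hf) (hsymm hg) (hsymm hh)
    (hM.torusDeriv_bracket_apply P hU hx hg hh) (hM.torusDeriv_bracket_apply P hU hx hh hf)
    (hM.torusDeriv_bracket_apply P hU hx hf hg)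

end IsComplexToricManifold

end OrbitBivector

/-! ### Toric bivector fields are determined by their value at a point of the open orbit -/

section DenseOrbit

variable {n : ℕ} {V : Type*} [NormedAddCommGroup V] {Λ : AddSubgroup V}
  {M : Type*} [TopologicalSpace M] [ChartedSpace (Fin n → ℂ) M] [AddAction (V ⧸ Λ) M]

/-- Two smooth toric bivector fields which agree at one point of a dense orbit are equal. -/
theorem BivectorField.eq_of_isToric_of_isSmooth [IsManifold 𝓘(ℝ, Fin n → ℂ) ∞ M] {x₀ : M}
    (hx₀ : Dense (AddAction.orbit (V ⧸ Λ) x₀)) {π ρ : BivectorField n M}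
    (hπ : BivectorField.IsSmooth π) (hρ : BivectorField.IsSmooth ρ)
    (hπt : BivectorField.IsToric Λ π) (hρt : BivectorField.IsToric Λ ρ) (h : π x₀ = ρ x₀) :
    π = ρ := by
  funext x
  let c := chartAt (Fin n → ℂ) x
  have hc : c ∈ atlas (Fin n → ℂ) M := chart_mem_atlas _ x
  have hx : x ∈ c.source := mem_chart_source _ x
  have key (α β : CCotangent (Fin n → ℂ)) :
      (CBivector.map (realDeriv c x) (π x)).1 α β = (CBivector.map (realDeriv c x) (ρ x)).1 α β := by
    have heq : Set.EqOn (fun y => (CBivector.map (realDeriv c y) (π y)).1 α β)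
        (fun y => (CBivector.map (realDeriv c y) (ρ y)).1 α β)
        (c.source ∩ AddAction.orbit (V ⧸ Λ) x₀) := by
      rintro _ ⟨-, t, rfl⟩
      simp only [← hπt t x₀, ← hρt t x₀, h]
    exact heq.of_subset_closure (hπ c hc α β).continuousOn (hρ c hc α β).continuousOn
      Set.inter_subset_left
      (hx₀.open_subset_closure_inter c.open_source) hx
  let e := (mdifferentiable_of_mem_atlas (I := 𝓘(ℝ, Fin n → ℂ)) hc).mfderiv hx
  let D : (Fin n → ℂ) →L[ℝ] (Fin n → ℂ) := e.symm.toContinuousLinearMap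
  have hD : D.comp (realDeriv c x) = ContinuousLinearMap.id ℝ (Fin n → ℂ) := by
    ext v : 1
    exact e.symm_apply_apply v
  -- the differential of a chart is invertible, so it may be cancelled
  have h1 := congrArg (CBivector.map D) (CBivector.ext_apply key)
  rwa [CBivector.map_map, CBivector.map_map, hD, CBivector.map_id, CBivector.map_id] at h1

end DenseOrbit

section OpenOrbit

variable {n : ℕ} {V : Type*} [NormedAddCommGroup V] [NormedSpace ℂ V] {Λ : AddSubgroup V}
  {M : Type*} [TopologicalSpace M] [ChartedSpace (Fin n → ℂ) M] [AddAction (V ⧸ Λ) M]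

namespace IsComplexToricManifold

/-- At a point of an open orbit the differential of the orbit map is invertible.  By equivariance
its rank is constant along the orbit, and if it were not maximal, then the orbit would be a null
set in charts. -/
theorem exists_equiv_eq_orbitDeriv [IsManifold 𝓘(ℝ, Fin n → ℂ) ∞ M]
    (hM : IsComplexToricManifold n Λ M) {x : M} (hx : IsOpen (AddAction.orbit (V ⧸ Λ) x)) :
    ∃ A : V ≃L[ℝ] (Fin n → ℂ), (A : V →L[ℝ] (Fin n → ℂ)) = orbitDeriv n Λ x := by
  obtain ⟨ξ, -⟩ := hM.lattice
  have : FiniteDimensional ℂ V := ξ.finiteDimensional_of_finite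
  let e : V ≃L[ℝ] (Fin n → ℂ) := (ξ.equivFun.restrictScalars ℝ).toContinuousLinearEquiv
  let A : (Fin n → ℂ) →L[ℝ] (Fin n → ℂ) :=
    (orbitDeriv n Λ x).comp (e.symm : (Fin n → ℂ) →L[ℝ] V)
  suffices hA : A.det ≠ 0 by
    refine ⟨e.trans (A.toContinuousLinearEquivOfDetNeZero hA), ?_⟩
    ext v
    simp [A]
  intro hA
  let c := chartAt (Fin n → ℂ) x
  let s : Set (Fin n → ℂ) := {z | expAct Λ (e.symm z) x ∈ c.source}
  -- the orbit map from a neighbourhood of `0` in `ℂⁿ ≅ V` to the chart at `x`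
  let f (z : Fin n → ℂ) : Fin n → ℂ := c (expAct Λ (e.symm z) x)
  -- by equivariance the differential of `f` at `z` is `A` followed by `K z`
  let K (z : Fin n → ℂ) : (Fin n → ℂ) →L[ℝ] (Fin n → ℂ) :=
    (realDeriv c (expAct Λ (e.symm z) x)).comp
      (realDeriv (n := n) (m := n)
        (fun y : M => (QuotientAddGroup.mk (e.symm z) : V ⧸ Λ) +ᵥ y) x)
  have hK (z : Fin n → ℂ) : ((K z).comp A).det = 0 := by
    have h : ((K z).comp A).det = (K z).det * A.det := LinearMap.det_comp _ _
    rw [h, hA, mul_zero]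
  have hf (z : Fin n → ℂ) (hz : z ∈ s) : HasFDerivWithinAt f ((K z).comp A) s z := by
    have h1 := hM.hasFDerivAt_comp_orbit (v := e.symm z) (x := x)
      ((mdifferentiable_of_mem_atlas (I := 𝓘(ℝ, Fin n → ℂ))
        (chart_mem_atlas (Fin n → ℂ) x)).mdifferentiableAt hz)
    have h2 := hM.realDeriv_vadd_comp_orbitDeriv (QuotientAddGroup.mk (e.symm z)) x
    have h3 := (h1.comp z (e.symm : (Fin n → ℂ) →L[ℝ] V).hasFDerivAt).hasFDerivWithinAt (s := s)
    change _ = orbitDeriv n Λ (expAct Λ (e.symm z) x) at h2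
    rw [← h2] at h3
    exact h3
  have h0 := MeasureTheory.addHaar_image_eq_zero_of_det_fderivWithin_eq_zero
    MeasureTheory.volume hf fun z _ => hK z
  have himage : f '' s = c '' (c.source ∩ AddAction.orbit (V ⧸ Λ) x) := by
    ext w
    constructor
    · rintro ⟨z, hz, rfl⟩
      exact ⟨_, ⟨hz, AddAction.mem_orbit _ _⟩, rfl⟩
    · rintro ⟨_, ⟨hy, t, rfl⟩, rfl⟩
      obtain ⟨v, hv⟩ := exists_expAct_eq (M := M) t
      simp only [hv] at hy ⊢
      exact ⟨e v, by simpa [s] using hy, by simp [f]⟩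
  have hopen : IsOpen (f '' s) := by
    rw [himage]
    exact c.isOpen_image_source_inter hx
  refine hopen.measure_ne_zero MeasureTheory.volume ⟨f 0, 0, ?_, rfl⟩ h0
  simp [s, expAct_zero, c]

end IsComplexToricManifold

end OpenOrbit

/-! ### Hermitian forms and toric Poisson structures -/

section Correspondence

variable {n : ℕ} {V : Type*} [NormedAddCommGroup V] [NormedSpace ℂ V]

/-- Multiplication of Hermitian forms by a nonzero real number. -/
noncomputable def HermitianFormDual.scale (r : ℝ) (hr : r ≠ 0) :
    HermitianFormDual V ≃ HermitianFormDual V where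
  toFun B := ⟨(r : ℂ) • B.1, fun f g => by simp [B.2 f g]⟩
  invFun B := ⟨((r⁻¹ : ℝ) : ℂ) • B.1, fun f g => by simp [B.2 f g]⟩
  left_inv B := Subtype.ext <| by simp [smul_smul, hr]
  right_inv B := Subtype.ext <| by simp [smul_smul, hr]

theorem HermitianFormDual.matrix_scale (r : ℝ) (hr : r ≠ 0) (B : HermitianFormDual V)
    (ξ : Module.Basis (Fin n) ℂ V) (p q : Fin n) :
    (HermitianFormDual.scale r hr B).matrix ξ p q = r * B.matrix ξ p q := rfl

variable {Λ : AddSubgroup V} {M : Type*} [TopologicalSpace M] [ChartedSpace (Fin n → ℂ) M]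
  [AddAction (V ⧸ Λ) M]

theorem orbitBivector_bivector_eq_sum (B : HermitianFormDual V) (ξ : Module.Basis (Fin n) ℂ V)
    (x : M) :
    orbitBivector n Λ M B.bivector x = (2 * Complex.I) • ∑ p, ∑ q, B.matrix ξ p q •
      wedge (holField Λ M (ξ p) x) (conjVec (holField Λ M (ξ q) x)) := by
  rw [orbitBivector, B.bivector_eq_sum ξ, CBivector.map_smul]
  simp only [CBivector.map_sum, CBivector.map_smul,
    CBivector.map_wedge_holPart _ (orbitDeriv_complex_smul x Complex.I)]
  rfl

namespace IsComplexToricManifold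

/-- The bijection `B ↦ 2i ∑ B_pq X_p ∧ X̄_q` from Hermitian forms onto real toric Poisson
structures of type `(1,1)`. -/
noncomputable def hermitianEquiv [IsManifold 𝓘(ℝ, Fin n → ℂ) ∞ M]
    (hM : IsComplexToricManifold n Λ M) : HermitianFormDual V ≃ RealToricPoisson11 n Λ M :=
  haveI : FiniteDimensional ℂ V := hM.lattice.choose.finiteDimensional_of_finite
  Equiv.ofBijective
    (fun B => ⟨orbitBivector n Λ M B.bivector, hM.orbitBivector_isPoisson _,
      hM.orbitBivector_isToric _, fun x => ⟨CBivector.IsReal.map B.bivector_isReal _,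
        CBivector.IsType11.map (B.bivector_isType11 hM.lattice.choose) _
          (orbitDeriv_complex_smul x Complex.I)⟩⟩) <| by
    obtain ⟨x₀, hopen, hdense⟩ := hM.openDenseOrbit
    obtain ⟨A, hA⟩ := hM.exists_equiv_eq_orbitDeriv hopen
    have hAI (v : Fin n → ℂ) : A.symm (Complex.I • v) = Complex.I • A.symm v := by
      have h (w : V) : A w = orbitDeriv n Λ x₀ w := congrArg (fun L => L w) hA
      apply A.injective
      rw [A.apply_symm_apply, h, orbitDeriv_complex_smul, ← h, A.apply_symm_apply]
    constructor
    · intro B C h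
      have h1 : CBivector.map (orbitDeriv n Λ x₀) B.bivector =
          CBivector.map (orbitDeriv n Λ x₀) C.bivector :=
        congrFun (congrArg Subtype.val h) x₀
      have h2 := congrArg (CBivector.map (A.symm : (Fin n → ℂ) →L[ℝ] V)) h1
      rw [CBivector.map_map, CBivector.map_map, ← hA, A.coe_symm_comp_coe, CBivector.map_id,
        CBivector.map_id] at h2
      exact HermitianFormDual.bivector_injective h2
    · rintro ⟨π, hP, ht, h11⟩
      obtain ⟨B, hB⟩ := HermitianFormDual.exists_bivector_eq
        (CBivector.IsReal.map (h11 x₀).1 (A.symm : (Fin n → ℂ) →L[ℝ] V))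
        (CBivector.IsType11.map (h11 x₀).2 (A.symm : (Fin n → ℂ) →L[ℝ] V) hAI)
      refine ⟨B, Subtype.ext <| BivectorField.eq_of_isToric_of_isSmooth hdense
        (hM.orbitBivector_isSmooth _) hP.smooth (hM.orbitBivector_isToric _) ht ?_⟩
      change CBivector.map (orbitDeriv n Λ x₀) B.bivector = π x₀
      rw [hB, CBivector.map_map, ← hA, A.coe_comp_coe_symm, CBivector.map_id]

theorem hermitianEquiv_apply [IsManifold 𝓘(ℝ, Fin n → ℂ) ∞ M]
    (hM : IsComplexToricManifold n Λ M) (B : HermitianFormDual V) :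
    (hM.hermitianEquiv B).1 = orbitBivector n Λ M B.bivector := rfl

/-- In a toric chart the vector field generated by `ξ_p` is `2πi z_p ∂/∂z_p`. -/
theorem realDeriv_comp_orbitDeriv_of_isToricChart [IsManifold 𝓘(ℝ, Fin n → ℂ) ∞ M]
    (hM : IsComplexToricManifold n Λ M) {ξ : Module.Basis (Fin n) ℂ V} {s : Set (Fin n)}
    {U : Set M} {φ : OpenPartialHomeomorph M (Fin n → ℂ)} (hφ : IsToricChart Λ ξ s U φ) {x : M}
    (hx : x ∈ U) (v : V) :
    (realDeriv φ x).comp (orbitDeriv n Λ x) v =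
      fun p => 2 * Real.pi * Complex.I * ξ.repr v p * φ x p := by
  have : FiniteDimensional ℂ V := ξ.finiteDimensional_of_finite
  have hU : IsOpen U := hφ.source_eq ▸ φ.open_source
  have hmd : MDifferentiableAt 𝓘(ℝ, Fin n → ℂ) 𝓘(ℝ, Fin n → ℂ) φ x :=
    (HasMFDerivAt.complexToReal ((hφ.holomorphic.contMDiffAt
      (hU.mem_nhds hx)).mdifferentiableAt (by simp)).hasMFDerivAt).mdifferentiableAt
  let l (p : Fin n) : V →L[ℝ] ℂ := dualToCovec ((2 * Real.pi * Complex.I : ℂ) • ξ.coord p)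
  have hl (p : Fin n) (w : V) : l p w = 2 * Real.pi * Complex.I * ξ.repr w p := rfl
  have h1 : HasFDerivAt (fun w : V => φ (expAct Λ w x))
      (ContinuousLinearMap.pi fun p => φ x p • l p) 0 := by
    have h2 : (fun w : V => φ (expAct Λ w x)) = fun w p => Complex.exp (l p w) * φ x p := by
      funext w p
      rw [(hφ.equivariant w x hx).2 p, hl]
    rw [h2, hasFDerivAt_pi]
    intro p
    have h3 := ((l p).hasFDerivAt (x := 0)).cexp.mul_const (φ x p)
    simpa using h3
  have h4 : HasFDerivAt (fun w : V => φ (expAct Λ w x)) (torusDeriv n Λ φ x) 0 :=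
    hM.hasFDerivAt_comp_orbit_zero hmd
  refine (congrArg (fun L : V →L[ℝ] (Fin n → ℂ) => L v) (h4.unique h1)).trans ?_
  funext p
  simp [hl, mul_comm]

end IsComplexToricManifold

end Correspondence

theorem theorem1p1 {n : ℕ} {V : Type*} [NormedAddCommGroup V] [NormedSpace ℂ V]
    (Λ : AddSubgroup V) (M : Type*) [TopologicalSpace M] [T2Space M] [SecondCountableTopology M]
    [ChartedSpace (Fin n → ℂ) M] [IsManifold 𝓘(ℂ, Fin n → ℂ) ω M] [AddAction (V ⧸ Λ) M]
    (hM : IsComplexToricManifold n Λ M) :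
    -- the correspondence `B ↔ 2i ∑ B_pq X_p ∧ X̄_q`
    (∃ Ψ : HermitianFormDual V ≃ RealToricPoisson11 n Λ M,
      ∀ (B : HermitianFormDual V) (ξ : Module.Basis (Fin n) ℂ V) (x : M),
        (Ψ B).1 x = (2 * Complex.I) • ∑ p, ∑ q, B.matrix ξ p q •
          wedge (holField Λ M (ξ p) x) (conjVec (holField Λ M (ξ q) x))) ∧
    -- the correspondence `B ↔ π_B = -2i ∑ B_pq Z_p ∧ Z̄_q`
    (∃ Φ : HermitianFormDual V ≃ RealToricPoisson11 n Λ M,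
      (∀ (B : HermitianFormDual V) (ξ : Module.Basis (Fin n) ℂ V) (x : M),
        (Φ B).1 x = (-2 * Complex.I) • ∑ p, ∑ q, B.matrix ξ p q •
          wedge (holFieldZ Λ M (ξ p) x) (conjVec (holFieldZ Λ M (ξ q) x))) ∧
      -- the form of `π_B` in the distinguished charts attached to the open cones of the fan
      ∀ (F : SmoothFan n Λ) (U : PointedCone ℝ V → Set M), IsSmoothToricVariety Λ F U →
        ∀ ξ : Module.Basis (Fin n) ℂ V, IsIntegralBasis Λ ξ →
          PointedCone.hull ℝ (Set.range ξ) ∈ F.cones →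
        ∀ φ : OpenPartialHomeomorph M (Fin n → ℂ),
          IsToricChart Λ ξ Set.univ (U (PointedCone.hull ℝ (Set.range ξ))) φ →
        ∀ (B : HermitianFormDual V), ∀ x ∈ U (PointedCone.hull ℝ (Set.range ξ)),
          CBivector.map (realDeriv φ x) ((Φ B).1 x) = (-2 * Complex.I) • ∑ p, ∑ q,
            (B.matrix ξ p q * φ x p * conj (φ x q)) • wedge (partialZ p) (partialZBar q)) := by
  have : IsManifold 𝓘(ℝ, Fin n → ℂ) ∞ M :=
    have : IsManifold 𝓘(ℝ, Fin n → ℂ) ω M := IsManifold.complexToReal ω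
    inferInstance
  have hpi : (Real.pi : ℂ) ≠ 0 := mod_cast Real.pi_ne_zero
  have hr : -(4 * Real.pi ^ 2)⁻¹ ≠ 0 := neg_ne_zero.2 (inv_ne_zero (by positivity))
  -- `Z_p ∧ Z̄_q = |2πi|⁻² X_p ∧ X̄_q`, which accounts for the factor `-1/(4π²)`
  refine ⟨⟨hM.hermitianEquiv, fun B ξ x => orbitBivector_bivector_eq_sum B ξ x⟩,
    ⟨(HermitianFormDual.scale _ hr).trans hM.hermitianEquiv, fun B ξ x => ?_, ?_⟩⟩
  · rw [Equiv.trans_apply, hM.hermitianEquiv_apply, orbitBivector_bivector_eq_sum _ ξ]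
    simp only [holFieldZ, conjVec_smul, wedge_smul_smul, HermitianFormDual.matrix_scale,
      Finset.smul_sum, smul_smul]
    refine Finset.sum_congr rfl fun p _ => Finset.sum_congr rfl fun q _ => ?_
    congr 1
    simp only [map_inv₀, map_mul, Complex.conj_ofReal, Complex.conj_I, map_ofNat]
    push_cast
    field_simp
    simp only [Complex.I_sq]
    ring
  · intro F U _ ξ _ _ φ hφ B x hx
    have hK := hM.realDeriv_comp_orbitDeriv_of_isToricChart hφ hx
    have hI (v : V) : (realDeriv (n := n) (m := n) φ x).comp (orbitDeriv n Λ x) (Complex.I • v) =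
        Complex.I • (realDeriv (n := n) (m := n) φ x).comp (orbitDeriv n Λ x) v := by
      rw [hK, hK]
      funext p
      simp only [map_smul, Finsupp.smul_apply, Pi.smul_apply, smul_eq_mul]
      ring
    have hξ (p : Fin n) : (realDeriv (n := n) (m := n) φ x).comp (orbitDeriv n Λ x) (ξ p) =
        (2 * Real.pi * Complex.I * φ x p) • (Pi.single p 1 : Fin n → ℂ) := by
      rw [hK]
      funext q
      by_cases h : q = p
      · subst h; simp
      · simp [h]
    rw [Equiv.trans_apply, hM.hermitianEquiv_apply, orbitBivector, CBivector.map_map,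
      HermitianFormDual.bivector_eq_sum _ ξ, CBivector.map_smul]
    simp only [CBivector.map_sum, CBivector.map_smul, CBivector.map_wedge_holPart _ hI, hξ,
      holPart_smul, conjVec_smul, wedge_smul_smul, HermitianFormDual.matrix_scale,
      Finset.smul_sum, smul_smul]
    refine Finset.sum_congr rfl fun p _ => Finset.sum_congr rfl fun q _ => ?_
    rw [partialZBar, partialZ, partialZ]
    congr 1
    simp only [map_mul, Complex.conj_ofReal, Complex.conj_I, map_ofNat]
    push_cast
    field_simp
    simp only [Complex.I_sq]
    ring
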